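/- Let $A>1$ and $q>0$. There is a constant $c>0$, depending only on $A$ and $q$, such that for every dimension $d\ge 1$, every integer $M\ge 2$ and every integer $n$ with $\log M\le 16(\min(1,A-1))^2 n$, $$\sup_{f_1,\dots,f_M\in\mathcal F_H(A)}\ \inf_{\hat f_n}\ \sup_{f\in\mathcal F(A)}\Big[\mathbb E_f\big[H(\hat f_n,f)^q\big]-\min_{j=1,\dots,M}H(f_j,f)^q\Big]\ \ge\ c\Big(\frac{\log M}{n}\Big)^{q/2}.$$ Here $\mathcal F_H(A)$ is the set of non-negative measurable functions on $\mathbb R^d$ bounded by $A$; $\mathcal F(A)$ is the set of probability densities on $\mathbb R^d$ with respect to Lebesgue measure that are bounded by $A$; $H(f,g)=\big(\int_{\mathbb R^d}(\sqrt{f(x)}-\sqrt{g(x)})^2\,dx\big)^{1/2}\in[0,\infty]$ is the Hellinger distance; the infimum is over all estimators $\hat f_n$ based on a sample of size $n$, i.e. all non-negative jointly measurable functions $\hat f_n(X_1,\dots,X_n;x)$; and $\mathbb E_f$ is the expectation when $X_1,\dots,X_n$ are i.i.d. with density $f$. The bracket takes values in $[-\infty,\infty]$, with $\infty-\infty:=-\infty$.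 -/

import Mathlib

open MeasureTheory
open scoped ENNReal

namespace Aggregation

/-- The Hellinger distance `‖√f - √g‖_{L²(ν)}` between non-negative measurable functions,
with values in `[0, ∞]`. -/
noncomputable def hellinger {X : Type*} [MeasurableSpace X] (ν : Measure X) (f g : X → ℝ) :
    ℝ≥0∞ :=
  eLpNorm (fun x => √(f x) - √(g x)) 2 ν

/-- Non-negative measurable functions bounded by `A`. -/
def boundedNonneg (X : Type*) [MeasurableSpace X] (A : ℝ) : Set (X → ℝ) :=
  {f | Measurable f ∧ (∀ x, 0 ≤ f x) ∧ ∀ x, f x ≤ A}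

/-- Probability densities with respect to `ν` bounded by `A`. -/
def boundedDensities {X : Type*} [MeasurableSpace X] (ν : Measure X) (A : ℝ) : Set (X → ℝ) :=
  {f | f ∈ boundedNonneg X A ∧ ∫⁻ x, ENNReal.ofReal (f x) ∂ν = 1}

/-- The law of an i.i.d. sample of size `n` with density `f` with respect to `ν`. -/
noncomputable def sampleLaw {X : Type*} [MeasurableSpace X] (ν : Measure X) (f : X → ℝ)
    (n : ℕ) : Measure (Fin n → X) :=
  Measure.pi fun _ => ν.withDensity fun x => ENNReal.ofReal (f x)

/-- Estimators based on a sample of size `n`: jointly measurable maps sending a sample and a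
point to the value at that point of the estimate, a non-negative function. -/
def estimators (X : Type*) [MeasurableSpace X] (n : ℕ) : Set ((Fin n → X) → X → ℝ) :=
  {T | Measurable (Function.uncurry T) ∧ ∀ s x, 0 ≤ T s x}

/-- The risk `𝔼_f [H(T, f) ^ q]`, with values in `[0, ∞]`. -/
noncomputable def hellingerRisk {X : Type*} [MeasurableSpace X] (ν : Measure X) (q : ℝ) {n : ℕ}
    (T : (Fin n → X) → X → ℝ) (f : X → ℝ) : ℝ≥0∞ :=
  ∫⁻ s, hellinger ν (T s) f ^ q ∂(sampleLaw ν f n)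

/-- The excess risk `𝔼_f [H(T, f) ^ q] - min_j H(g_j, f) ^ q` as an extended real number.
With the conventions of `EReal`, `∞ - ∞ = -∞`, the choice that makes lower bounds hardest. -/
noncomputable def excessHellingerRisk {X : Type*} [MeasurableSpace X] (ν : Measure X) (q : ℝ)
    {n M : ℕ} (g : Fin M → X → ℝ) (T : (Fin n → X) → X → ℝ) (f : X → ℝ) : EReal :=
  (hellingerRisk ν q T f : EReal) - ((⨅ j, hellinger ν (g j) f ^ q : ℝ≥0∞) : EReal)

end Aggregation

/-! The dictionary consists of the densities `1 + ε cos(2πk x₀)` on the unit cube, `k = 1, …, M`,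
with `ε = √(log M / n) / 4`. The unknown density may be any of them, so the oracle term vanishes and
only the risk needs a lower bound. Orthogonality of the cosines separates the densities by `ε / 4`
in Hellinger distance (`ofReal_div_four_le_hellinger`), while the chi-square divergence of their
sample laws from the uniform one is at most `(1 + ε²)^n - 1 ≤ M / 16`. An accurate estimator would
identify the true density, which `exists_setIntegral_le_of_pairwise_disjoint` forbids. -/

namespace Aggregation

/-! ### Product laws, chi-square divergence and multiple testing -/

/-- A product of measures with densities has the product density. -/
theorem pi_withDensity_ofReal {ι X : Type*} [Fintype ι] [MeasurableSpace X] (μ : Measure X)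
    [IsFiniteMeasure μ] {g : X → ℝ} (hg : Integrable g μ) (h0 : ∀ x, 0 ≤ g x) :
    Measure.pi (fun _ : ι => μ.withDensity fun x => ENNReal.ofReal (g x)) =
      (Measure.pi fun _ : ι => μ).withDensity fun s => ENNReal.ofReal (∏ i, g (s i)) := by
  have : IsFiniteMeasure (μ.withDensity fun x => ENNReal.ofReal (g x)) :=
    isFiniteMeasure_withDensity_ofReal hg.2
  refine Measure.pi_eq fun t ht => ?_
  rw [withDensity_apply _ (MeasurableSet.univ_pi ht), Measure.restrict_pi_pi,
    ← ofReal_integral_eq_lintegral_ofReal, integral_fintype_prod_eq_prod (fun _ => g),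
    ENNReal.ofReal_prod_of_nonneg]
  · refine Finset.prod_congr rfl fun i _ => ?_
    rw [withDensity_apply _ (ht i), ofReal_integral_eq_lintegral_ofReal hg.restrict
      (Filter.Eventually.of_forall h0)]
  · exact fun i _ => integral_nonneg h0
  · exact Integrable.fintype_prod fun i => hg.restrict
  · exact Filter.Eventually.of_forall fun s => Finset.prod_nonneg fun i _ => h0 _

/-- If the likelihood ratios of `M` alternatives with respect to one reference law have
chi-square divergence at most `M / 16`, then no test recognises all of them with probability
more than `3 / 4`. -/
theorem exists_setIntegral_le_of_pairwise_disjoint {Ω : Type*} [MeasurableSpace Ω]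
    (μ : Measure Ω) [IsProbabilityMeasure μ] {M : ℕ} (hM : 2 ≤ M) {L : Fin M → Ω → ℝ}
    (hL : ∀ j, Integrable (L j) μ) (hL2 : ∀ j, Integrable (fun s => (L j s - 1) ^ 2) μ)
    (hchi : ∀ j, ∫ s, (L j s - 1) ^ 2 ∂μ ≤ (M : ℝ) / 16)
    {B : Fin M → Set Ω} (hB : ∀ j, MeasurableSet (B j))
    (hdisj : Pairwise fun i j => Disjoint (B i) (B j)) :
    ∃ j, ∫ s in B j, L j s ∂μ ≤ 3 / 4 := by
  by_contra! hcon
  have hM0 : (2 : ℝ) ≤ M := by exact_mod_cast hM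
  have hb : ∀ j, ∫ s in B j, L j s ∂μ ≤ (1 + M / 8) * μ.real (B j) + 1 / 8 := by
    intro j
    have h1 : ∫ s in B j, L j s ∂μ ≤
        ∫ s in B j, ((1 + M / 8 : ℝ) + 2 / M * (L j s - 1) ^ 2) ∂μ := by
      refine setIntegral_mono (hL j).integrableOn
        ((integrable_const _).add ((hL2 j).const_mul _)).integrableOn fun s => ?_
      -- Young's inequality for `L - 1`, weighted so that the chi-square bound `M / 16` contributes
      -- exactly `1 / 8`.
      have h : 0 ≤ 2 / (M : ℝ) * (L j s - 1 - M / 4) ^ 2 := by positivity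
      have h' : 2 / (M : ℝ) * (L j s - 1 - M / 4) ^ 2 =
          2 / M * (L j s - 1) ^ 2 - (L j s - 1) + M / 8 := by
        field_simp
        ring
      show L j s ≤ (1 + M / 8 : ℝ) + 2 / M * (L j s - 1) ^ 2
      linarith
    rw [integral_add (integrable_const _) ((hL2 j).const_mul _).integrableOn,
      setIntegral_const, integral_const_mul] at h1
    have h2 : ∫ s in B j, (L j s - 1) ^ 2 ∂μ ≤ (M : ℝ) / 16 :=
      (setIntegral_le_integral (hL2 j) (Filter.Eventually.of_forall fun s => sq_nonneg _)).trans
        (hchi j)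
    have h3 : 2 / (M : ℝ) * ∫ s in B j, (L j s - 1) ^ 2 ∂μ ≤ 2 / M * (M / 16) := by gcongr
    have h4 : 2 / (M : ℝ) * (M / 16) = 1 / 8 := by field_simp; norm_num
    rw [smul_eq_mul, mul_comm] at h1
    linarith
  have hsum : ∑ j, μ.real (B j) ≤ 1 := by
    rw [← measureReal_iUnion_fintype hdisj hB]
    exact measureReal_le_one
  have h1 : ∑ j : Fin M, (3 / 4 : ℝ) < ∑ j : Fin M, ((1 + M / 8) * μ.real (B j) + 1 / 8) := by
    refine Finset.sum_lt_sum_of_nonempty ⟨⟨0, by omega⟩, Finset.mem_univ _⟩ fun j _ => ?_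
    exact (hcon j).trans_le (hb j)
  rw [Finset.sum_add_distrib, ← Finset.mul_sum] at h1
  simp only [Finset.sum_const, Finset.card_univ, Fintype.card_fin, nsmul_eq_mul] at h1
  have h2 : (1 + M / 8 : ℝ) * ∑ j, μ.real (B j) ≤ 1 + M / 8 :=
    mul_le_of_le_one_right (by positivity) hsum
  -- What remains is `3M/4 < 1 + M/4`, that is `M < 2`; the level `3 / 4` is just attained at `M =
  -- 2`.
  linarith

/-- The chi-square divergence of a product of perturbations of a probability measure. -/
theorem integral_prod_one_add_sub_one_sq_le {X : Type*} [MeasurableSpace X] (μ : Measure X)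
    [IsProbabilityMeasure μ] {r : X → ℝ} (hr : Measurable r) {ε : ℝ} (hb : ∀ x, |r x| ≤ ε)
    (h0 : ∫ x, r x ∂μ = 0) (n : ℕ) :
    (Integrable (fun s : Fin n → X => ∏ i, (1 + r (s i))) (Measure.pi fun _ => μ)) ∧
    (Integrable (fun s : Fin n → X => (∏ i, (1 + r (s i)) - 1) ^ 2) (Measure.pi fun _ => μ)) ∧
    ∫ s : Fin n → X, (∏ i, (1 + r (s i)) - 1) ^ 2 ∂(Measure.pi fun _ => μ) ≤
      (1 + ε ^ 2) ^ n - 1 := by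
  have ir : Integrable r μ := Integrable.of_bound hr.aestronglyMeasurable ε
    (Filter.Eventually.of_forall hb)
  have hsq : ∀ x, r x ^ 2 ≤ ε ^ 2 := fun x => sq_le_sq' (abs_le.1 (hb x)).1 (abs_le.1 (hb x)).2
  have ir2 : Integrable (fun x => r x ^ 2) μ :=
    Integrable.of_bound (hr.pow_const 2).aestronglyMeasurable (ε ^ 2)
      (Filter.Eventually.of_forall fun x => by simpa using hsq x)
  have i1 : Integrable (fun x => 1 + r x) μ := (integrable_const _).add ir
  have e2 : (fun x => (1 + r x) ^ 2) = fun x => (1 + 2 * r x) + r x ^ 2 := by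
    ext x; ring
  have i3 : Integrable (fun x => 1 + 2 * r x) μ := (integrable_const _).add (ir.const_mul 2)
  have i2 : Integrable (fun x => (1 + r x) ^ 2) μ := by rw [e2]; exact i3.add ir2
  have j1 : Integrable (fun s : Fin n → X => ∏ i, (1 + r (s i))) (Measure.pi fun _ => μ) :=
    Integrable.fintype_prod fun _ => i1
  have j2 : Integrable (fun s : Fin n → X => ∏ i, (1 + r (s i)) ^ 2) (Measure.pi fun _ => μ) :=
    Integrable.fintype_prod (f := fun _ x => (1 + r x) ^ 2) fun _ => i2
  -- After expansion each product integrates factor by factor; since `r` has mean zero, the plain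
  -- product has integral `1`.
  have e : (fun s : Fin n → X => (∏ i, (1 + r (s i)) - 1) ^ 2) =
      fun s => (∏ i, (1 + r (s i)) ^ 2 - 2 * ∏ i, (1 + r (s i))) + 1 := by
    ext s
    rw [Finset.prod_pow]
    ring
  have j3 : Integrable (fun s : Fin n → X => ∏ i, (1 + r (s i)) ^ 2 - 2 * ∏ i, (1 + r (s i)))
    (Measure.pi fun _ => μ) := j2.sub (j1.const_mul 2)
  refine ⟨j1, ?_, ?_⟩
  · rw [e]
    exact j3.add (integrable_const _)
  · rw [e, integral_add j3 (integrable_const _), integral_sub j2 (j1.const_mul 2),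
      integral_const_mul, integral_fintype_prod_eq_pow (fun x => (1 + r x) ^ 2),
      integral_fintype_prod_eq_pow (fun x => 1 + r x)]
    have k1 : ∫ x, (1 + r x) ∂μ = 1 := by
      rw [integral_add (integrable_const _) ir, h0]; simp
    have k2 : ∫ x, (1 + r x) ^ 2 ∂μ ≤ 1 + ε ^ 2 := by
      rw [e2, integral_add i3 ir2, integral_add (integrable_const _) (ir.const_mul 2),
        integral_const_mul, h0]
      have : ∫ x, r x ^ 2 ∂μ ≤ ∫ _, ε ^ 2 ∂μ := integral_mono ir2 (integrable_const _) hsq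
      simp at this ⊢
      exact this
    have k3 : (∫ x, (1 + r x) ^ 2 ∂μ) ^ n ≤ (1 + ε ^ 2) ^ n :=
      pow_le_pow_left₀ (integral_nonneg fun x => sq_nonneg _) k2 n
    rw [k1]
    simp
    linarith

/-- The power is at most `exp (log M / 16) = M ^ (1/16)`, and Bernoulli's inequality for exponents
in `[0, 1]` bounds this by `1 + (M - 1) / 16`. -/
theorem one_add_pow_sub_one_le {M n : ℕ} (hM : 2 ≤ M) {ε : ℝ}
    (h : n * ε ^ 2 ≤ Real.log M / 16) : (1 + ε ^ 2) ^ n - 1 ≤ (M : ℝ) / 16 := by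
  have hM0 : (2 : ℝ) ≤ M := by exact_mod_cast hM
  have h1 : (1 + ε ^ 2) ^ n ≤ (M : ℝ) ^ (1 / 16 : ℝ) := by
    calc (1 + ε ^ 2) ^ n ≤ Real.exp (ε ^ 2) ^ n := by
          gcongr
          linarith [Real.add_one_le_exp (ε ^ 2)]
      _ = Real.exp (n * ε ^ 2) := (Real.exp_nat_mul _ _).symm
      _ ≤ Real.exp (Real.log M * (1 / 16)) := Real.exp_le_exp.2 (by linarith)
      _ = _ := (Real.rpow_def_of_pos (by linarith) _).symm
  have h2 := rpow_one_add_le_one_add_mul_self (s := (M : ℝ) - 1) (p := 1 / 16)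
    (by linarith) (by norm_num) (by norm_num)
  rw [add_sub_cancel] at h2
  linarith

/-- Factor `a - b = (√a + √b)(√a - √b)` and use `(√a + √b)² ≤ 2(a + b) ≤ 8`. This turns `L²`
separation into Hellinger separation. -/
theorem sub_sq_le_eight_mul_sqrt_sub_sq {a b : ℝ} (ha : 0 ≤ a) (hb : 0 ≤ b) (ha2 : a ≤ 2)
    (hb2 : b ≤ 2) : (a - b) ^ 2 ≤ 8 * (√a - √b) ^ 2 := by
  have e : (a - b) ^ 2 = (√a + √b) ^ 2 * (√a - √b) ^ 2 := by
    rw [← mul_pow, ← sq_sub_sq, Real.sq_sqrt ha, Real.sq_sqrt hb]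
  rw [e]
  gcongr
  nlinarith [Real.sq_sqrt ha, Real.sq_sqrt hb, sq_nonneg (√a - √b)]

/-! ### Orthogonality of cosines on the unit cube -/

theorem integral_cos_two_pi_int {k : ℤ} (hk : k ≠ 0) :
    ∫ x in (0 : ℝ)..1, Real.cos (2 * Real.pi * k * x) = 0 := by
  have h : 2 * Real.pi * k ≠ 0 := by
    have : (k : ℝ) ≠ 0 := by exact_mod_cast hk
    positivity
  rw [intervalIntegral.integral_comp_mul_left _ h, integral_cos]
  have : Real.sin (2 * Real.pi * k * 1) = 0 := by
    have := Real.sin_int_mul_pi (2 * k)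
    push_cast at this
    rw [← this]; ring_nf
  rw [this]; simp

/-- The two squared cosines each have mean `1 / 2`; every other term is a cosine of frequency `2k`,
`2l`, `k + l` or `k - l`, all nonzero. -/
theorem integral_cos_sub_cos_sq {k l : ℤ} (hk : 0 < k) (hl : 0 < l) (hkl : k ≠ l) :
    ∫ x in (0 : ℝ)..1, (Real.cos (2 * Real.pi * k * x) - Real.cos (2 * Real.pi * l * x)) ^ 2 =
      1 := by
  have e : ∀ x : ℝ, (Real.cos (2 * Real.pi * k * x) - Real.cos (2 * Real.pi * l * x)) ^ 2 =
      1 + (1 / 2) * Real.cos (2 * Real.pi * (2 * k : ℤ) * x)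
        + (1 / 2) * Real.cos (2 * Real.pi * (2 * l : ℤ) * x)
        - Real.cos (2 * Real.pi * (k + l : ℤ) * x) - Real.cos (2 * Real.pi * (k - l : ℤ) * x) := by
    intro x
    have a1 := Real.cos_two_mul (2 * Real.pi * k * x)
    have a2 := Real.cos_two_mul (2 * Real.pi * l * x)
    have a3 := Real.cos_add (2 * Real.pi * k * x) (2 * Real.pi * l * x)
    have a4 := Real.cos_sub (2 * Real.pi * k * x) (2 * Real.pi * l * x)
    rw [show 2 * Real.pi * (2 * k : ℤ) * x = 2 * (2 * Real.pi * k * x) by push_cast; ring,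
      show 2 * Real.pi * (2 * l : ℤ) * x = 2 * (2 * Real.pi * l * x) by push_cast; ring,
      show 2 * Real.pi * (k + l : ℤ) * x = 2 * Real.pi * k * x + 2 * Real.pi * l * x by
        push_cast; ring,
      show 2 * Real.pi * (k - l : ℤ) * x = 2 * Real.pi * k * x - 2 * Real.pi * l * x by
        push_cast; ring, a1, a2, a3, a4]
    ring
  have ii : ∀ f : ℝ → ℝ, Continuous f → IntervalIntegrable f volume 0 1 :=
    fun f hf => hf.intervalIntegrable _ _
  simp_rw [e]
  rw [intervalIntegral.integral_sub (ii _ (by fun_prop)) (ii _ (by fun_prop)),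
    intervalIntegral.integral_sub (ii _ (by fun_prop)) (ii _ (by fun_prop)),
    intervalIntegral.integral_add (ii _ (by fun_prop)) (ii _ (by fun_prop)),
    intervalIntegral.integral_add (ii _ (by fun_prop)) (ii _ (by fun_prop)),
    intervalIntegral.integral_const_mul, intervalIntegral.integral_const_mul,
    integral_cos_two_pi_int (by omega), integral_cos_two_pi_int (by omega),
    integral_cos_two_pi_int (by omega), integral_cos_two_pi_int (by omega)]
  simp

/-- A coordinate of a uniform point of the cube is uniform on the interval, so the bounds do not
depend on `d`. -/
theorem integral_cube_comp_eval {d : ℕ} (i : Fin d) (f : ℝ → ℝ) (hf : Continuous f) :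
    ∫ x in Set.univ.pi fun _ : Fin d => Set.Ioc (0 : ℝ) 1, f (x i) = ∫ x in (0 : ℝ)..1, f x := by
  have : IsProbabilityMeasure (volume.restrict (Set.Ioc (0 : ℝ) 1)) := ⟨by simp⟩
  rw [volume_pi, Measure.restrict_pi_pi, intervalIntegral.integral_of_le zero_le_one]
  have h := measurePreserving_eval (fun _ : Fin d => volume.restrict (Set.Ioc (0 : ℝ) 1)) i
  have e := integral_map (f := f) h.measurable.aemeasurable (by
    rw [h.map_eq]; exact hf.aestronglyMeasurable)
  rw [h.map_eq] at e
  exact e.symm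

/-! ### The Hellinger distance -/

theorem hellinger_sq {X : Type*} [MeasurableSpace X] (ν : Measure X) (f g : X → ℝ) :
    hellinger ν f g ^ 2 = ∫⁻ x, ENNReal.ofReal ((√(f x) - √(g x)) ^ 2) ∂ν := by
  have h := eLpNorm_nnreal_pow_eq_lintegral (μ := ν) (f := fun x => √(f x) - √(g x))
    (p := 2) two_ne_zero
  simp only [ENNReal.coe_ofNat, NNReal.coe_ofNat, ENNReal.rpow_ofNat] at h
  rw [hellinger, h]
  refine lintegral_congr fun x => ?_
  rw [← ofReal_norm, ← ENNReal.ofReal_pow (norm_nonneg _), Real.norm_eq_abs, sq_abs]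

theorem hellinger_self {X : Type*} [MeasurableSpace X] (ν : Measure X) (f : X → ℝ) :
    hellinger ν f f = 0 := by
  simp [hellinger]

theorem hellinger_le_add {X : Type*} [MeasurableSpace X] (ν : Measure X) {f g h : X → ℝ}
    (hf : Measurable f) (hg : Measurable g) (hh : Measurable h) :
    hellinger ν f g ≤ hellinger ν h f + hellinger ν h g := by
  have e : (fun x => √(f x) - √(g x)) =
      (fun x => √(h x) - √(g x)) - fun x => √(h x) - √(f x) := by
    ext x; simp
  rw [hellinger, e, add_comm]
  exact eLpNorm_sub_le (hh.sqrt.sub hg.sqrt).aestronglyMeasurable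
    (hh.sqrt.sub hf.sqrt).aestronglyMeasurable one_le_two

theorem measurable_hellinger {X S : Type*} [MeasurableSpace X] [MeasurableSpace S] (ν : Measure X)
    [SFinite ν] {T : S → X → ℝ} (hT : Measurable (Function.uncurry T)) {f : X → ℝ}
    (hf : Measurable f) : Measurable fun s => hellinger ν (T s) f := by
  have e : (fun s => hellinger ν (T s) f) =
      fun s => (∫⁻ x, ENNReal.ofReal ((√(T s x) - √(f x)) ^ 2) ∂ν) ^ (1 / 2 : ℝ) := by
    ext s
    rw [← hellinger_sq, ← ENNReal.rpow_natCast, ← ENNReal.rpow_mul]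
    norm_num
  rw [e]
  refine Measurable.pow_const ?_ _
  refine Measurable.lintegral_prod_right'
    (f := fun p : S × X => ENNReal.ofReal ((√(T p.1 p.2) - √(f p.2)) ^ 2)) ?_
  have h : Measurable fun p : S × X => T p.1 p.2 := hT
  exact ((h.sqrt.sub (hf.comp measurable_snd).sqrt).pow_const 2).ennreal_ofReal

/-! ### Perturbations of the uniform density on a set of measure one -/

section Perturbation

variable {X : Type*} [MeasurableSpace X] {ν : Measure X} {C : Set X}

theorem indicator_one_add_mem_boundedDensities (hC : MeasurableSet C) (hν : ν C = 1) {r : X → ℝ}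
    (hr : Measurable r) {ε A : ℝ} (hε : ε ≤ 1) (hεA : ε ≤ A - 1) (hb : ∀ x, |r x| ≤ ε)
    (hA : 0 ≤ A) (h0 : ∫ x in C, r x ∂ν = 0) :
    (C.indicator fun x => 1 + r x) ∈ boundedDensities ν A := by
  have : IsProbabilityMeasure (ν.restrict C) := ⟨by simp [hν]⟩
  have hp : ∀ x, 0 ≤ 1 + r x := fun x => by linarith [(abs_le.1 (hb x)).1]
  have ir : Integrable r (ν.restrict C) := Integrable.of_bound hr.aestronglyMeasurable ε
    (Filter.Eventually.of_forall hb)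
  refine ⟨⟨(hr.const_add 1).indicator hC, fun x => Set.indicator_nonneg (fun x _ => hp x) x,
    fun x => ?_⟩, ?_⟩
  · by_cases hx : x ∈ C
    · rw [Set.indicator_of_mem hx]
      linarith [(abs_le.1 (hb x)).2]
    · rw [Set.indicator_of_notMem hx]
      exact hA
  · have e : (fun x => ENNReal.ofReal (C.indicator (fun x => 1 + r x) x)) =
        C.indicator fun x => ENNReal.ofReal (1 + r x) := by
      ext x
      by_cases hx : x ∈ C <;> simp [hx]
    have ir1 : Integrable (fun x => 1 + r x) (ν.restrict C) := (integrable_const 1).add ir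
    rw [e, lintegral_indicator hC, ← ofReal_integral_eq_lintegral_ofReal ir1 (Filter.Eventually.of_forall hp),
      integral_add (integrable_const 1) ir, h0]
    simp

theorem sampleLaw_indicator_one_add (hC : MeasurableSet C) (hν : ν C = 1) {r : X → ℝ}
    (hr : Measurable r) {ε : ℝ} (hε : ε ≤ 1) (hb : ∀ x, |r x| ≤ ε) (n : ℕ) :
    sampleLaw ν (C.indicator fun x => 1 + r x) n =
      (Measure.pi fun _ : Fin n => ν.restrict C).withDensity
        fun s => ENNReal.ofReal (∏ i, (1 + r (s i))) := by
  have : IsProbabilityMeasure (ν.restrict C) := ⟨by simp [hν]⟩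
  have e : (fun x => ENNReal.ofReal (C.indicator (fun x => 1 + r x) x)) =
      C.indicator fun x => ENNReal.ofReal (1 + r x) := by
    ext x
    by_cases hx : x ∈ C <;> simp [hx]
  have ir : Integrable r (ν.restrict C) := Integrable.of_bound hr.aestronglyMeasurable ε
    (Filter.Eventually.of_forall hb)
  rw [sampleLaw, e, withDensity_indicator hC,
    ← pi_withDensity_ofReal (g := fun x => 1 + r x) _ ((integrable_const 1).add ir)
      fun x => by linarith [(abs_le.1 (hb x)).1]]

theorem ofReal_div_four_le_hellinger (hC : MeasurableSet C) (hν : ν C = 1) {r r' : X → ℝ}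
    (hr : Measurable r) (hr' : Measurable r') {ε : ℝ} (hε0 : 0 ≤ ε) (hε : ε ≤ 1)
    (hb : ∀ x, |r x| ≤ ε) (hb' : ∀ x, |r' x| ≤ ε)
    (hsep : ε ^ 2 ≤ ∫ x in C, (r x - r' x) ^ 2 ∂ν) :
    ENNReal.ofReal (ε / 4) ≤
      hellinger ν (C.indicator fun x => 1 + r x) (C.indicator fun x => 1 + r' x) := by
  have : IsProbabilityMeasure (ν.restrict C) := ⟨by simp [hν]⟩
  refine (ENNReal.pow_le_pow_left_iff two_ne_zero).1 ?_
  rw [hellinger_sq,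
    ← ENNReal.ofReal_pow (by positivity)]
  have hi : Integrable (fun x => (r x - r' x) ^ 2 / 8) (ν.restrict C) := by
    refine Integrable.of_bound (((hr.sub hr').pow_const 2).div_const 8).aestronglyMeasurable 1
      (Filter.Eventually.of_forall fun x => ?_)
    have h1 := abs_le.1 (hb x)
    have h2 := abs_le.1 (hb' x)
    rw [Real.norm_of_nonneg (by positivity)]
    have : (r x - r' x) ^ 2 ≤ 2 ^ 2 := sq_le_sq' (by linarith) (by linarith)
    linarith
  calc ENNReal.ofReal ((ε / 4) ^ 2)
      ≤ ENNReal.ofReal (∫ x in C, (r x - r' x) ^ 2 / 8 ∂ν) := by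
        refine ENNReal.ofReal_le_ofReal ?_
        rw [integral_div]
        -- The separation is in fact `ε / √8`; `ε / 4` is a rounder value below it.
        linarith [sq_nonneg ε]
    _ = ∫⁻ x in C, ENNReal.ofReal ((r x - r' x) ^ 2 / 8) ∂ν :=
        ofReal_integral_eq_lintegral_ofReal hi
          (Filter.Eventually.of_forall fun x => by positivity)
    _ ≤ ∫⁻ x in C, ENNReal.ofReal ((√(C.indicator (fun x => 1 + r x) x) -
          √(C.indicator (fun x => 1 + r' x) x)) ^ 2) ∂ν := by
        refine setLIntegral_mono' hC fun x hx => ENNReal.ofReal_le_ofReal ?_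
        rw [Set.indicator_of_mem hx, Set.indicator_of_mem hx]
        have h1 := abs_le.1 (hb x)
        have h2 := abs_le.1 (hb' x)
        have := sub_sq_le_eight_mul_sqrt_sub_sq (a := 1 + r x) (b := 1 + r' x) (by linarith)
          (by linarith) (by linarith) (by linarith)
        rw [add_sub_add_left_eq_sub] at this
        linarith
    _ ≤ _ := setLIntegral_le_lintegral _ _

/-- Every estimator has a large risk at one of `M` separated perturbations of a uniform density. -/
theorem exists_le_hellingerRisk_indicator_one_add [SFinite ν] (hC : MeasurableSet C)
    (hν : ν C = 1) {M n : ℕ} (hM : 2 ≤ M) {r : Fin M → X → ℝ} (hr : ∀ j, Measurable (r j))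
    {ε : ℝ} (hε0 : 0 ≤ ε) (hε : ε ≤ 1) (hb : ∀ j x, |r j x| ≤ ε)
    (h0 : ∀ j, ∫ x in C, r j x ∂ν = 0)
    (hsep : ∀ i j, i ≠ j → ε ^ 2 ≤ ∫ x in C, (r i x - r j x) ^ 2 ∂ν)
    (hεn : n * ε ^ 2 ≤ Real.log M / 16) {q : ℝ} (hq : 0 < q) {T : (Fin n → X) → X → ℝ}
    (hT : T ∈ estimators X n) :
    ∃ j, ENNReal.ofReal ((ε / 8) ^ q / 4) ≤
      hellingerRisk ν q T (C.indicator fun x => 1 + r j x) := by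
  have : IsProbabilityMeasure (ν.restrict C) := ⟨by simp [hν]⟩
  have hf : ∀ j, Measurable (C.indicator fun x => 1 + r j x) :=
    fun j => ((hr j).const_add 1).indicator hC
  have hH := fun j => measurable_hellinger ν hT.1 (hf j)
  -- The radius is half the separation, so by the triangle inequality these events are disjoint.
  set B : Fin M → Set (Fin n → X) := fun j =>
    {s | hellinger ν (T s) (C.indicator fun x => 1 + r j x) < ENNReal.ofReal (ε / 8)} with hBdef
  have hB : ∀ j, MeasurableSet (B j) := fun j => measurableSet_lt (hH j) measurable_const
  have hdisj : Pairwise fun i j => Disjoint (B i) (B j) := by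
    intro i j hij
    refine Set.disjoint_left.2 fun s hi hj => ?_
    have h1 := ofReal_div_four_le_hellinger hC hν (hr i) (hr j) hε0 hε (hb i) (hb j)
      (hsep i j hij)
    have h2 := hellinger_le_add ν (hf i) (hf j) (hT.1.of_uncurry_left (x := s))
    have h3 := h1.trans_lt (h2.trans_lt (ENNReal.add_lt_add hi hj))
    rw [← ENNReal.ofReal_add (by positivity) (by positivity)] at h3
    refine h3.ne ?_
    congr 1; ring
  have hchi := fun j => integral_prod_one_add_sub_one_sq_le (ν.restrict C) (hr j) (hb j) (h0 j) n
  obtain ⟨j, hj⟩ := exists_setIntegral_le_of_pairwise_disjoint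
    (Measure.pi fun _ : Fin n => ν.restrict C) hM
    (fun j => (hchi j).1) (fun j => (hchi j).2.1)
    (fun j => (hchi j).2.2.trans (one_add_pow_sub_one_le hM hεn)) hB hdisj
  refine ⟨j, ?_⟩
  -- The bound `2` is a dummy: only the total mass `1` is used.
  have hd := (indicator_one_add_mem_boundedDensities (A := 2) hC hν (hr j) hε (by linarith) (hb j)
    zero_le_two (h0 j)).2
  have hprob : IsProbabilityMeasure (sampleLaw ν (C.indicator fun x => 1 + r j x) n) := by
    have : IsProbabilityMeasure
        (ν.withDensity fun x => ENNReal.ofReal (C.indicator (fun x => 1 + r j x) x)) :=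
      ⟨by rw [withDensity_apply _ MeasurableSet.univ, Measure.restrict_univ, hd]⟩
    unfold sampleLaw
    infer_instance
  have hPB : sampleLaw ν (C.indicator fun x => 1 + r j x) n (B j) ≤ ENNReal.ofReal (3 / 4) := by
    rw [sampleLaw_indicator_one_add hC hν (hr j) hε (hb j), withDensity_apply _ (hB j),
      ← ofReal_integral_eq_lintegral_ofReal (hchi j).1.integrableOn
        (Filter.Eventually.of_forall fun s => Finset.prod_nonneg fun i _ => by
          linarith [(abs_le.1 (hb j (s i))).1])]
    exact ENNReal.ofReal_le_ofReal hj
  have hPBc : ENNReal.ofReal (1 / 4) ≤ sampleLaw ν (C.indicator fun x => 1 + r j x) n (B j)ᶜ := by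
    rw [prob_compl_eq_one_sub (hB j)]
    refine le_trans ?_ (tsub_le_tsub_left hPB 1)
    rw [← ENNReal.ofReal_one, ← ENNReal.ofReal_sub _ (by norm_num)]
    norm_num
  have hsub : (B j)ᶜ ⊆ {s | ENNReal.ofReal (ε / 8) ^ q ≤
      hellinger ν (T s) (C.indicator fun x => 1 + r j x) ^ q} := fun s hs =>
    ENNReal.rpow_le_rpow (not_lt.1 hs) hq.le
  -- Markov's inequality on the complement of `B j`, which has probability at least `1 / 4`.
  calc ENNReal.ofReal ((ε / 8) ^ q / 4)
      = ENNReal.ofReal (ε / 8) ^ q * ENNReal.ofReal (1 / 4) := by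
        rw [ENNReal.ofReal_rpow_of_nonneg (by positivity) hq.le,
          ← ENNReal.ofReal_mul (by positivity)]
        congr 1; ring
    _ ≤ ENNReal.ofReal (ε / 8) ^ q * sampleLaw ν (C.indicator fun x => 1 + r j x) n
          {s | ENNReal.ofReal (ε / 8) ^ q ≤
            hellinger ν (T s) (C.indicator fun x => 1 + r j x) ^ q} := by
        gcongr
        exact hPBc.trans (measure_mono hsub)
    _ ≤ _ := mul_meas_ge_le_lintegral ((hH j).pow_const q) _

end Perturbation

end Aggregation

/-! ### The cosine dictionary and the lower bound -/

theorem mainTheorem2 (A : ℝ) (hA : 1 < A) (q : ℝ) (hq : 0 < q) :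
    ∃ c : ℝ, 0 < c ∧ ∀ d : ℕ, 1 ≤ d → ∀ M : ℕ, 2 ≤ M → ∀ n : ℕ,
      Real.log M ≤ 16 * (min 1 (A - 1)) ^ 2 * n →
      ((c * (Real.log M / n) ^ (q / 2) : ℝ) : EReal) ≤
        ⨆ g : Fin M → Aggregation.boundedNonneg (Fin d → ℝ) A,
          ⨅ T : Aggregation.estimators (Fin d → ℝ) n,
            ⨆ f : Aggregation.boundedDensities (volume : Measure (Fin d → ℝ)) A,
              Aggregation.excessHellingerRisk (volume : Measure (Fin d → ℝ)) q
                (fun j => (g j : (Fin d → ℝ) → ℝ)) (T : (Fin n → Fin d → ℝ) → (Fin d → ℝ) → ℝ)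
                (f : (Fin d → ℝ) → ℝ) := by
  -- Here `32 = 4 · 8`, from `ε = √(log M / n) / 4` and the radius `ε / 8`; the last `4` comes from
  -- the probability `1 / 4`.
  refine ⟨(1 / 32) ^ q / 4, by positivity, fun d hd M hM n hn => ?_⟩
  have hM1 : (1 : ℝ) < M := by exact_mod_cast hM
  have hlog : 0 < Real.log M := Real.log_pos hM1
  have hm0 : 0 < min 1 (A - 1) := lt_min one_pos (by linarith)
  have hn0 : (0 : ℝ) < n := by
    by_contra! h
    have : 16 * (min 1 (A - 1)) ^ 2 * (n : ℝ) ≤ 0 :=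
      mul_nonpos_of_nonneg_of_nonpos (by positivity) h
    linarith
  set ε : ℝ := √(Real.log M / n) / 4 with hεdef
  have hε0 : 0 ≤ ε := by positivity
  have hε2 : ε ^ 2 = Real.log M / n / 16 := by
    rw [hεdef, div_pow, Real.sq_sqrt (by positivity)]; norm_num
  -- The condition on `n` says exactly this: the perturbed densities stay non-negative and below
  -- `A`.
  have hεm : ε ≤ min 1 (A - 1) := by
    refine le_of_sq_le_sq ?_ hm0.le
    rw [hε2, div_div, div_le_iff₀ (by positivity)]
    linarith
  have hεn : n * ε ^ 2 ≤ Real.log M / 16 := by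
    rw [hε2]; field_simp; rfl
  have hcε : (1 / 32 : ℝ) ^ q / 4 * (Real.log M / n) ^ (q / 2) = (ε / 8) ^ q / 4 := by
    have : ε / 8 = 1 / 32 * √(Real.log M / n) := by rw [hεdef]; ring
    rw [this, Real.mul_rpow (by norm_num) (by positivity), Real.sqrt_eq_rpow,
      ← Real.rpow_mul (by positivity)]
    ring_nf
  let i₀ : Fin d := ⟨0, hd⟩
  let C : Set (Fin d → ℝ) := Set.univ.pi fun _ => Set.Ioc (0 : ℝ) 1
  have hC : MeasurableSet C := MeasurableSet.univ_pi fun _ => measurableSet_Ioc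
  have hν : (volume : Measure (Fin d → ℝ)) C = 1 := by simp [C, Real.volume_pi_Ioc]
  -- The shift avoids frequency zero, whose cosine is constant and has nonzero mean.
  let k : Fin M → ℤ := fun j => (j : ℕ) + 1
  have hk : ∀ j, 0 < k j := fun j => by positivity
  let r : Fin M → (Fin d → ℝ) → ℝ := fun j x => ε * Real.cos (2 * Real.pi * k j * x i₀)
  have hr : ∀ j, Measurable (r j) := fun j => by fun_prop
  have hb : ∀ j x, |r j x| ≤ ε := fun j x => by
    rw [abs_mul, abs_of_nonneg hε0]
    exact mul_le_of_le_one_right hε0 (Real.abs_cos_le_one _)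
  have h0 : ∀ j, ∫ x in C, r j x = 0 := fun j => by
    rw [Aggregation.integral_cube_comp_eval i₀
      (fun y => ε * Real.cos (2 * Real.pi * k j * y)) (by fun_prop),
      intervalIntegral.integral_const_mul, Aggregation.integral_cos_two_pi_int (hk j).ne', mul_zero]
  have hsep : ∀ i j, i ≠ j → ε ^ 2 ≤ ∫ x in C, (r i x - r j x) ^ 2 := fun i j hij => by
    have hkij : k i ≠ k j := fun h => hij (Fin.ext (by simpa [k] using h))
    have e : ∀ x, (r i x - r j x) ^ 2 = ε ^ 2 *
        (Real.cos (2 * Real.pi * k i * x i₀) - Real.cos (2 * Real.pi * k j * x i₀)) ^ 2 :=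
      fun x => by ring
    simp_rw [e]
    rw [integral_const_mul, Aggregation.integral_cube_comp_eval i₀
      (fun y => (Real.cos (2 * Real.pi * k i * y) - Real.cos (2 * Real.pi * k j * y)) ^ 2)
      (by fun_prop), Aggregation.integral_cos_sub_cos_sq (hk i) (hk j) hkij, mul_one]
  have hmem := fun j => Aggregation.indicator_one_add_mem_boundedDensities hC hν (hr j)
    (hεm.trans (min_le_left _ _)) (hεm.trans (min_le_right _ _)) (hb j) (by linarith) (h0 j)
  refine le_iSup_of_le (fun j => ⟨_, (hmem j).1⟩) (le_iInf fun T => ?_)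
  obtain ⟨j, hj⟩ := Aggregation.exists_le_hellingerRisk_indicator_one_add hC hν hM hr hε0
    (hεm.trans (min_le_left _ _)) hb h0 hsep hεn hq T.2
  refine le_iSup_of_le ⟨_, hmem j⟩ ?_
  -- The true density belongs to the dictionary, so no `∞ - ∞` arises.
  have hmin : (⨅ i, Aggregation.hellinger (volume : Measure (Fin d → ℝ))
      (C.indicator fun x => 1 + r i x) (C.indicator fun x => 1 + r j x) ^ q) = 0 := by
    refine le_antisymm (iInf_le_of_le j ?_) zero_le
    rw [Aggregation.hellinger_self, ENNReal.zero_rpow_of_pos hq]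
  rw [Aggregation.excessHellingerRisk, hmin, hcε, EReal.coe_ennreal_zero, sub_zero,
    ← max_eq_left (show 0 ≤ (ε / 8) ^ q / 4 by positivity), ← EReal.coe_ennreal_ofReal]
  exact EReal.coe_ennreal_le_coe_ennreal_iff.2 hj
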